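/- Let $\alpha>-1$ and $\beta>0$. For $n\ge 1$ consider the Jacobi unitary ensemble whose eigenvalues $(x_1,\dots,x_n)\in[0,1]^n$ have joint probability density $$\frac1{C_n}\prod_{1\le i<j\le n}(x_i-x_j)^2\prod_{k=1}^n x_k^{\alpha}(1-x_k)^{\beta},$$ where $C_n$ is the normalization constant, and let $\mathbb P(t,\alpha,\beta,n)$ be the probability that all eigenvalues lie in $[t,1]$. Let $G$ be the Barnes $G$-function ($G(z+1)=\Gamma(z)G(z)$, $G(1)=1$), given by $$G(1+w)=(2\pi)^{w/2}e^{-(w+(1+\gamma)w^2)/2}\prod_{k\ge1}\Big(1+\frac wk\Big)^k e^{w^2/(2k)-w},$$ with $\gamma$ the Euler–Mascheroni constant. Then there are a sequence $E_{\alpha,\beta}(n)$, independent of $t$, and functions $F_{n,\alpha,\beta}(t)$ such that for every $n\ge1$ and every $0<t<1$ the probability $\mathbb P(t,\alpha,\beta,n)$ is positive and $$\begin{aligned} \log\mathbb{P}(t,\alpha,\beta,n) =\;&n(n+\beta)\log(1-t)+n\alpha\log t+\log \frac{G(\alpha+1)}{(2\pi)^{\alpha/2}}+\frac{3}{4}\alpha^2\\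 &+\left[\frac{n^2}{2}-\frac{1}{12}\right]\log n+\left[\frac{(n+\beta)^2}{2}-\frac{1}{12}\right]\log (n+\beta)\\ &+\left[\frac{(2n+\alpha+\beta)^2}{2}-\frac{1}{12}\right]\log (2n+\alpha+\beta)+\left[\frac{1}{12}-\frac{(n+\alpha)^2}{2}\right]\log(n+\alpha)\\ &+\left[\frac{1}{12}-\frac{(2n+\beta)^2}{2}\right]\log (2n+\beta)+\left[\frac{1}{12}-\frac{(n+\alpha+\beta)^2}{2}\right]\log(n+\alpha+\beta)\\ &+E_{\alpha,\beta}(n)+F_{n,\alpha,\beta}(t), \end{aligned}$$ where $E_{\alpha,\beta}(n)=O_{\alpha,\beta}(n^{-1})$ as $n\to\infty$, and, for each fixed $n\ge1$, $F_{n,\alpha,\beta}(t)=O_{n,\alpha,\beta}(1-t)$ as $t\to1^-$. -/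

import Mathlib

open Real Set Filter Topology MeasureTheory Asymptotics

noncomputable section

/-- The Jacobi weight `w(x, α, β) = x ^ α * (1 - x) ^ β`, used for `x ∈ [0, 1]`. -/
def jacobiWeight (α β x : ℝ) : ℝ := x ^ α * (1 - x) ^ β

/-- The unnormalised joint eigenvalue density of the Jacobi unitary ensemble,
`∏_{i < j} (x_i - x_j)² ∏_k w(x_k, α, β)`. -/
def jueWeight (n : ℕ) (α β : ℝ) (x : Fin n → ℝ) : ℝ :=
  (∏ i : Fin n, ∏ j ∈ Finset.Ioi i, (x i - x j) ^ 2) * ∏ k : Fin n, jacobiWeight α β (x k)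

/-- The normalisation constant `C_n`: the integral of the unnormalised density over `[0, 1]^n`. -/
def jueConst (n : ℕ) (α β : ℝ) : ℝ :=
  ∫ x in Set.univ.pi fun _ : Fin n => Icc (0 : ℝ) 1, jueWeight n α β x

/-- The law of the `n` eigenvalues of the Jacobi unitary ensemble: the measure on `[0, 1]^n` with
density `(1 / C_n) ∏_{i < j} (x_i - x_j)² ∏_k w(x_k, α, β)` with respect to Lebesgue measure. -/
def jueLaw (n : ℕ) (α β : ℝ) : Measure (Fin n → ℝ) :=
  (volume.restrict (Set.univ.pi fun _ : Fin n => Icc (0 : ℝ) 1)).withDensity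
    fun x => ENNReal.ofReal (1 / jueConst n α β * jueWeight n α β x)

/-- The probability `ℙ(t, α, β, n)` that all `n` eigenvalues of the Jacobi unitary ensemble
lie in `[t, 1]`. -/
def jueProb (t α β : ℝ) (n : ℕ) : ℝ :=
  (jueLaw n α β).real (Set.univ.pi fun _ : Fin n => Icc t 1)

/-- The Barnes G-function on the real line, by its Weierstrass product: with `w = z - 1`,
`G (1 + w) = (2π)^(w/2) exp (-(w + (1 + γ) w²) / 2) ∏_{k ≥ 1} (1 + w/k)^k exp (w²/(2k) - w)`,
where `γ` is the Euler-Mascheroni constant. It satisfies `G (z + 1) = Γ(z) G(z)`, `G 1 = 1`. -/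
def barnesG (z : ℝ) : ℝ :=
  (2 * π) ^ ((z - 1) / 2) *
    Real.exp (-((z - 1) + (1 + eulerMascheroniConstant) * (z - 1) ^ 2) / 2) *
    ∏' k : ℕ, (1 + (z - 1) / ((k : ℝ) + 1)) ^ (k + 1) *
      Real.exp ((z - 1) ^ 2 / (2 * ((k : ℝ) + 1)) - (z - 1))

end

/-!
The substitution `x = 1 - (1 - t) y` turns the mass of `[t, 1] ^ n` under the weight with `α = 0`
into `(1 - t) ^ (n (n + β))` times `jueConst n 0 β` (`setIntegral_jueWeight_zero_left`), and on
`[t, 1] ^ n` the missing factor `∏ x_k ^ α` is `exp (O(n |α| |log t|))`. Hence, up to an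
`O(1 - t)` which also absorbs `n α log t`, the logarithm of the probability is
`n (n + β) log (1 - t) + log (jueConst n 0 β / jueConst n α β)` (`abs_log_jueProb_sub_le`).

The normalisation constants are Selberg integrals with exponent `γ = 1`. Writing the squared
Vandermonde product as the determinant of the powers of `x` times that of the powers of `1 - x`,
Andréief's identity `integral_det_mul_det` reduces them to a determinant of Beta integrals, that is,
to `det (1 / Γ(c + i + j))`, which is of Vandermonde type (`det_inv_Gamma`). Factors not depending
on `α` and `β` drop out of the ratio and are left implicit in `exists_jueConst_eq`. The logarithm of
the ratio becomes a combination of the sums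
`logGammaRatioSum w m = ∑_{j < m} (log Γ(w + j + 1) - log Γ(j + 1))` with `m = n` and `m = 2 n`.

Summation by parts expresses such a sum through `log Γ(w + m + 1) - log Γ(m + 1)`, the partial sums
of the logarithm of the Weierstrass product of `G(1 + w)`, and the harmonic number `H_m`. Each
of these is known up to an error making a contribution `O(1 / m)`: a null sequence with increments
`O(1 / m ^ (p + 1))` is `O(1 / m ^ p)` (`isBigO_of_tendsto_zero_of_sub_isBigO`), and the increments
are elementary. This gives `logGammaRatioSumError_isBigO`; in the combination that occurs, the terms
`log G(1 + α + β)` and `log G(1 + β)` cancel and only `log G(1 + α)` remains.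
-/

/-! ### The Andréief identity -/

/-- The product of two determinants, expanded over pairs of permutations. -/
theorem det_mul_det_eq_sum_perm {n : ℕ} (A B : Matrix (Fin n) (Fin n) ℝ) :
    A.det * B.det = ∑ σ : Equiv.Perm (Fin n), ∑ τ : Equiv.Perm (Fin n),
      ((Equiv.Perm.sign σ : ℤ) : ℝ) * ((Equiv.Perm.sign τ : ℤ) : ℝ) *
        ∏ k, (A k (σ k) * B k (τ k)) := by
  rw [← A.det_transpose, ← B.det_transpose, Matrix.det_apply', Matrix.det_apply',
    Finset.sum_mul_sum]
  refine Finset.sum_congr rfl fun σ _ => Finset.sum_congr rfl fun τ _ => ?_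
  simp only [Matrix.transpose_apply, Finset.prod_mul_distrib]
  ring

section Andreief

variable {n : ℕ} {X : Type*} [MeasurableSpace X] (μ : Measure X) [SigmaFinite μ]
  (f g : Fin n → X → ℝ)

theorem integrable_det_mul_det (h : ∀ i j, Integrable (fun x => f i x * g j x) μ) :
    Integrable (fun x : Fin n → X => (Matrix.of fun i j => f j (x i)).det *
      (Matrix.of fun i j => g j (x i)).det) (Measure.pi fun _ => μ) := by
  simp only [det_mul_det_eq_sum_perm, Matrix.of_apply]
  refine integrable_finsetSum _ fun σ _ => integrable_finsetSum _ fun τ _ => ?_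
  exact (Integrable.fintype_prod (f := fun k x => f (σ k) x * g (τ k) x)
    fun k => h (σ k) (τ k)).const_mul _

/-- **Andréief's identity**: the integral of a product of two determinants of functions is
`n!` times the determinant of their pairings. -/
theorem integral_det_mul_det (h : ∀ i j, Integrable (fun x => f i x * g j x) μ) :
    ∫ x : Fin n → X, (Matrix.of fun i j => f j (x i)).det *
      (Matrix.of fun i j => g j (x i)).det ∂(Measure.pi fun _ => μ) =
    n.factorial * (Matrix.of fun i j => ∫ x, f i x * g j x ∂μ).det := by
  set M : Matrix (Fin n) (Fin n) ℝ := Matrix.of fun i j => ∫ x, f i x * g j x ∂μ with hM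
  have hint : ∀ σ τ : Equiv.Perm (Fin n), Integrable (fun x : Fin n → X =>
      ((Equiv.Perm.sign σ : ℤ) : ℝ) * ((Equiv.Perm.sign τ : ℤ) : ℝ) *
        ∏ k, (f (σ k) (x k) * g (τ k) (x k))) (Measure.pi fun _ => μ) := fun σ τ =>
    (Integrable.fintype_prod (f := fun k x => f (σ k) x * g (τ k) x)
      fun k => h (σ k) (τ k)).const_mul _
  have hσ : ∀ σ : Equiv.Perm (Fin n), ∑ τ : Equiv.Perm (Fin n),
      ((Equiv.Perm.sign σ : ℤ) : ℝ) * ((Equiv.Perm.sign τ : ℤ) : ℝ) * ∏ k, M (σ k) (τ k)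
      = M.det := by
    intro σ
    have h1 := Matrix.det_permute σ M
    have h2 : (M.submatrix σ id).det = ∑ τ : Equiv.Perm (Fin n),
        ((Equiv.Perm.sign τ : ℤ) : ℝ) * ∏ k, M (σ k) (τ k) := by
      rw [← Matrix.det_transpose, Matrix.det_apply']
      simp
    simp only [mul_assoc]
    rw [← Finset.mul_sum, ← h2, h1, ← mul_assoc]
    rcases Int.units_eq_one_or (Equiv.Perm.sign σ) with h | h <;> simp [h]
  simp only [det_mul_det_eq_sum_perm, Matrix.of_apply]
  rw [integral_finsetSum _ fun σ _ => integrable_finsetSum _ fun τ _ => hint σ τ]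
  simp_rw [integral_finsetSum _ fun τ _ => hint _ τ, integral_const_mul]
  have hp : ∀ σ τ : Equiv.Perm (Fin n), ∫ x : Fin n → X, ∏ k, (f (σ k) (x k) * g (τ k) (x k))
      ∂(Measure.pi fun _ => μ) = ∏ k, M (σ k) (τ k) := fun σ τ =>
    integral_fintype_prod_eq_prod (f := fun k x => f (σ k) x * g (τ k) x)
  simp_rw [hp, hσ]
  simp [Fintype.card_perm]

end Andreief

/-! ### The real Beta integral -/

theorem jacobiWeight_eqOn_betaPDFReal {a b : ℝ} (ha : -1 < a) (hb : -1 < b) :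
    EqOn (jacobiWeight a b) (fun x => ProbabilityTheory.beta (a + 1) (b + 1) *
      ProbabilityTheory.betaPDFReal (a + 1) (b + 1) x) (Ioo 0 1) := by
  intro x hx
  have := ProbabilityTheory.beta_pos (α := a + 1) (β := b + 1) (by linarith) (by linarith)
  simp only [jacobiWeight, ProbabilityTheory.betaPDFReal, hx.1, hx.2, and_self, if_true,
    add_sub_cancel_right]
  field_simp

theorem integrable_betaPDFReal {a b : ℝ} (ha : 0 < a) (hb : 0 < b) :
    Integrable (ProbabilityTheory.betaPDFReal a b) := by
  refine ⟨(ProbabilityTheory.stronglyMeasurable_betaPDFReal a b).aestronglyMeasurable, ?_⟩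
  rw [hasFiniteIntegral_iff_ofReal]
  · change ∫⁻ x, ProbabilityTheory.betaPDF a b x < _
    simp [ProbabilityTheory.lintegral_betaPDF_eq_one ha hb]
  · refine Eventually.of_forall fun x => ?_
    by_cases hx : 0 < x ∧ x < 1
    · exact (ProbabilityTheory.betaPDFReal_pos hx.1 hx.2 ha hb).le
    · simp [ProbabilityTheory.betaPDFReal, hx]

theorem integral_betaPDFReal {a b : ℝ} (ha : 0 < a) (hb : 0 < b) :
    ∫ x, ProbabilityTheory.betaPDFReal a b x = 1 := by
  rw [integral_eq_lintegral_of_nonneg_ae]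
  · change (∫⁻ x, ProbabilityTheory.betaPDF a b x).toReal = _
    simp [ProbabilityTheory.lintegral_betaPDF_eq_one ha hb]
  · refine Eventually.of_forall fun x => ?_
    by_cases hx : 0 < x ∧ x < 1
    · exact (ProbabilityTheory.betaPDFReal_pos hx.1 hx.2 ha hb).le
    · simp [ProbabilityTheory.betaPDFReal, hx]
  · exact (ProbabilityTheory.stronglyMeasurable_betaPDFReal a b).aestronglyMeasurable

theorem integrableOn_jacobiWeight {a b : ℝ} (ha : -1 < a) (hb : -1 < b) :
    IntegrableOn (jacobiWeight a b) (Icc 0 1) := by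
  rw [integrableOn_Icc_iff_integrableOn_Ioo]
  refine IntegrableOn.congr_fun ?_ (jacobiWeight_eqOn_betaPDFReal ha hb).symm measurableSet_Ioo
  exact ((integrable_betaPDFReal (by linarith) (by linarith)).const_mul _).integrableOn

theorem integral_jacobiWeight {a b : ℝ} (ha : -1 < a) (hb : -1 < b) :
    ∫ x in Icc (0 : ℝ) 1, jacobiWeight a b x =
      Gamma (a + 1) * Gamma (b + 1) / Gamma (a + b + 2) := by
  rw [integral_Icc_eq_integral_Ioo,
    setIntegral_congr_fun measurableSet_Ioo (jacobiWeight_eqOn_betaPDFReal ha hb),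
    integral_const_mul, setIntegral_eq_integral_of_forall_compl_eq_zero,
    integral_betaPDFReal (by linarith) (by linarith), mul_one, ProbabilityTheory.beta]
  · ring_nf
  · intro x hx
    exact if_neg hx

/-- Multiplying the Jacobi weight by powers of `x` and `1 - x` shifts its parameters. -/
theorem pow_mul_pow_mul_jacobiWeight (a b : ℝ) (i j : ℕ) {x : ℝ} (hx : x ∈ Ioo (0 : ℝ) 1) :
    x ^ i * ((1 - x) ^ j * jacobiWeight a b x) = jacobiWeight (a + i) (b + j) x := by
  rw [jacobiWeight, jacobiWeight, rpow_add_natCast hx.1.ne', rpow_add_natCast (by linarith [hx.2])]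
  ring

/-! ### Evaluation of the normalisation constant -/

theorem Gamma_add_nat {c : ℝ} (hc : 0 < c) (m : ℕ) :
    Gamma (c + m) = Gamma c * ∏ k ∈ Finset.range m, (c + k) := by
  induction m with
  | zero => simp
  | succ m ih =>
    rw [Finset.prod_range_succ, ← mul_assoc, ← ih, Nat.cast_succ, ← add_assoc,
      Gamma_add_one (by positivity), mul_comm]

/-- After factoring `1 / Γ(c + i + n - 1)` out of row `i`, the entries of `1 / Γ(c + i + (n-1-j))`
are monic polynomials of degree `j` in `i`, so the determinant is of Vandermonde type. -/
theorem det_inv_Gamma (n : ℕ) {c : ℝ} (hc : 0 < c) :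
    (Matrix.of fun i j : Fin n => (Gamma (c + (i : ℕ) + (Fin.rev j : ℕ)))⁻¹).det =
      (∏ i : Fin n, (Gamma (c + (i : ℕ) + (n - 1 : ℕ)))⁻¹) *
        (Matrix.vandermonde fun i : Fin n => ((i : ℕ) : ℝ)).det := by
  open Polynomial in
  let p : Fin n → ℝ[X] := fun j =>
    ∏ k ∈ Finset.range j, (X + C (c + (Fin.rev j : ℕ) + k))
  have hmon : ∀ j, (p j).Monic := fun j => monic_prod_of_monic _ _ fun k _ => monic_X_add_C _
  have hdeg : ∀ j, (p j).natDegree = j := fun j => by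
    rw [Polynomial.natDegree_prod_of_monic _ _ fun k _ => monic_X_add_C _]
    simp only [Polynomial.natDegree_X_add_C, Finset.sum_const, Finset.card_range, smul_eq_mul,
      mul_one]
  rw [Matrix.det_eval_matrixOfPolynomials_eq_det_vandermonde _ p hdeg hmon,
    ← Matrix.det_mul_column]
  congr 1
  ext i j
  simp only [Matrix.of_apply, p, Polynomial.eval_prod, Polynomial.eval_add, Polynomial.eval_X,
    Polynomial.eval_C]
  have hpos : 0 < c + (i : ℕ) + (Fin.rev j : ℕ) := by positivity
  have hsum : c + (i : ℕ) + (n - 1 : ℕ) = c + (i : ℕ) + (Fin.rev j : ℕ) + (j : ℕ) := by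
    have : n - 1 = (Fin.rev j : ℕ) + (j : ℕ) := by rw [Fin.val_rev]; omega
    rw [this]; push_cast; ring
  have hprod : ∏ k ∈ Finset.range j, (((i : ℕ) : ℝ) + (c + (Fin.rev j : ℕ) + k)) =
      ∏ k ∈ Finset.range j, (c + (i : ℕ) + (Fin.rev j : ℕ) + k) :=
    Finset.prod_congr rfl fun k _ => by ring
  have hne : ∏ k ∈ Finset.range j, (c + (i : ℕ) + (Fin.rev j : ℕ) + k) ≠ 0 :=
    Finset.prod_ne_zero_iff.2 fun k _ => by positivity
  rw [hsum, Gamma_add_nat hpos, hprod, mul_inv, mul_assoc, inv_mul_cancel₀ hne, mul_one]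

/-- The squared Vandermonde product, as a product of the Vandermonde determinants in `x` and in
`1 - x`, the columns of the latter being reversed. -/
theorem exists_vandermonde_sq_eq (n : ℕ) : ∃ ε : ℝ, ε ≠ 0 ∧ ∀ x : Fin n → ℝ,
    (∏ i : Fin n, ∏ j ∈ Finset.Ioi i, (x i - x j) ^ 2) =
      ε * ((Matrix.of fun i j : Fin n => x i ^ (j : ℕ)).det *
        (Matrix.of fun i j : Fin n => (1 - x i) ^ (Fin.rev j : ℕ)).det) := by
  refine ⟨((Equiv.Perm.sign (Fin.revPerm (n := n)) : ℤ) : ℝ) *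
    ∏ i : Fin n, ∏ j ∈ Finset.Ioi i, (-1 : ℝ), ?_, fun x => ?_⟩
  · refine mul_ne_zero (by simp) ?_
    exact Finset.prod_ne_zero_iff.2 fun i _ => Finset.prod_ne_zero_iff.2 fun j _ => by norm_num
  have h1 : (Matrix.of fun i j : Fin n => (1 - x i) ^ (Fin.rev j : ℕ)).det =
      ((Equiv.Perm.sign (Fin.revPerm (n := n)) : ℤ) : ℝ) *
        (Matrix.vandermonde fun i => 1 - x i).det := by
    rw [← Matrix.det_permute']
    rfl
  have h2 : (Matrix.of fun i j : Fin n => x i ^ (j : ℕ)).det =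
      (Matrix.vandermonde x).det := rfl
  have h3 : ((Equiv.Perm.sign (Fin.revPerm (n := n)) : ℤ) : ℝ) *
      ((Equiv.Perm.sign (Fin.revPerm (n := n)) : ℤ) : ℝ) = 1 := by
    rcases Int.units_eq_one_or (Equiv.Perm.sign (Fin.revPerm (n := n))) with h | h <;> simp [h]
  rw [h1, h2, Matrix.det_vandermonde, Matrix.det_vandermonde]
  calc _ = (∏ i : Fin n, ∏ j ∈ Finset.Ioi i, (-1 : ℝ)) *
        ((∏ i : Fin n, ∏ j ∈ Finset.Ioi i, (x j - x i)) *
          ∏ i : Fin n, ∏ j ∈ Finset.Ioi i, (1 - x j - (1 - x i))) := by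
        simp only [← Finset.prod_mul_distrib]
        exact Finset.prod_congr rfl fun i _ => Finset.prod_congr rfl fun j _ => by ring
    _ = _ := by
        linear_combination (-(∏ i : Fin n, ∏ j ∈ Finset.Ioi i, (-1 : ℝ)) *
        ((∏ i : Fin n, ∏ j ∈ Finset.Ioi i, (x j - x i)) *
          ∏ i : Fin n, ∏ j ∈ Finset.Ioi i, (1 - x j - (1 - x i)))) * h3

theorem volume_restrict_cube (n : ℕ) :
    (volume : Measure (Fin n → ℝ)).restrict (Set.univ.pi fun _ : Fin n => Icc (0 : ℝ) 1) =
      Measure.pi fun _ => volume.restrict (Icc (0 : ℝ) 1) :=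
  Measure.restrict_pi_pi (μ := fun _ : Fin n => (volume : Measure ℝ)) _

theorem moment_jacobiWeight {a b : ℝ} (ha : -1 < a) (hb : -1 < b) (i j : ℕ) :
    IntegrableOn (fun x => x ^ i * (jacobiWeight a b x * (1 - x) ^ j)) (Icc 0 1) ∧
    ∫ x in Icc (0 : ℝ) 1, x ^ i * (jacobiWeight a b x * (1 - x) ^ j) =
      Gamma (a + 1 + i) * Gamma (b + 1 + j) / Gamma (a + b + 2 + i + j) := by
  have hi : (0 : ℝ) ≤ i := Nat.cast_nonneg i
  have hj : (0 : ℝ) ≤ j := Nat.cast_nonneg j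
  have heq : EqOn (fun x => x ^ i * (jacobiWeight a b x * (1 - x) ^ j))
      (jacobiWeight (a + i) (b + j)) (Ioo 0 1) := fun x hx => by
    simp only [← pow_mul_pow_mul_jacobiWeight a b i j hx]; ring
  constructor
  · rw [integrableOn_Icc_iff_integrableOn_Ioo]
    refine IntegrableOn.congr_fun ?_ heq.symm measurableSet_Ioo
    exact (integrableOn_jacobiWeight (by linarith) (by linarith)).mono_set Ioo_subset_Icc_self
  · rw [integral_Icc_eq_integral_Ioo, setIntegral_congr_fun measurableSet_Ioo heq,
      ← integral_Icc_eq_integral_Ioo, integral_jacobiWeight (by linarith) (by linarith)]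
    ring_nf

theorem jueWeight_nonneg (n : ℕ) (a b : ℝ) {x : Fin n → ℝ}
    (hx : x ∈ Set.univ.pi fun _ : Fin n => Icc (0 : ℝ) 1) : 0 ≤ jueWeight n a b x := by
  refine mul_nonneg (Finset.prod_nonneg fun i _ => Finset.prod_nonneg fun j _ => sq_nonneg _)
    (Finset.prod_nonneg fun k _ => ?_)
  have := hx k (mem_univ k)
  exact mul_nonneg (rpow_nonneg this.1 _) (rpow_nonneg (by linarith [this.2]) _)

/-- The squared Vandermonde product times the Jacobi weights is, up to a constant, a product of two
determinants of one-variable functions. -/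
theorem exists_jueWeight_eq (n : ℕ) : ∃ ε : ℝ, ε ≠ 0 ∧ ∀ (a b : ℝ) (x : Fin n → ℝ),
    jueWeight n a b x = ε * ((Matrix.of fun i j : Fin n => x i ^ (j : ℕ)).det *
      (Matrix.of fun i j : Fin n =>
        jacobiWeight a b (x i) * (1 - x i) ^ (Fin.rev j : ℕ)).det) := by
  obtain ⟨ε, hε, h⟩ := exists_vandermonde_sq_eq n
  refine ⟨ε, hε, fun a b x => ?_⟩
  have := Matrix.det_mul_column (fun i => jacobiWeight a b (x i))
    (Matrix.of fun i j : Fin n => (1 - x i) ^ (Fin.rev j : ℕ))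
  simp only [Matrix.of_apply] at this
  rw [jueWeight, h, this]
  ring

theorem integrableOn_jueWeight (n : ℕ) {a b : ℝ} (ha : -1 < a) (hb : -1 < b) :
    IntegrableOn (jueWeight n a b) (Set.univ.pi fun _ : Fin n => Icc (0 : ℝ) 1) := by
  obtain ⟨ε, -, h⟩ := exists_jueWeight_eq n
  rw [IntegrableOn, volume_restrict_cube, funext (h a b)]
  exact (integrable_det_mul_det _ (fun (i : Fin n) (y : ℝ) => y ^ (i : ℕ))
    (fun (j : Fin n) (y : ℝ) => jacobiWeight a b y * (1 - y) ^ (Fin.rev j : ℕ))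
    fun i j => (moment_jacobiWeight ha hb i (Fin.rev j)).1).const_mul ε

/-- The Selberg integral with parameter `γ = 1`, up to a factor not depending on the exponents
of the weight. -/
theorem exists_jueConst_eq (n : ℕ) : ∃ κ : ℝ, κ ≠ 0 ∧ ∀ a b : ℝ, -1 < a → -1 < b →
    jueConst n a b = κ * ∏ j ∈ Finset.range n,
      (Gamma (a + 1 + j) * Gamma (b + 1 + j) / Gamma (a + b + 1 + n + j)) := by
  obtain ⟨ε, hε, h⟩ := exists_jueWeight_eq n
  refine ⟨ε * (n.factorial * (Matrix.vandermonde fun i : Fin n => ((i : ℕ) : ℝ)).det), ?_,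
    fun a b ha hb => ?_⟩
  · refine mul_ne_zero hε (mul_ne_zero (by positivity) (Matrix.det_vandermonde_ne_zero_iff.2 ?_))
    exact fun i j hij => Fin.ext (Nat.cast_injective hij)
  rw [jueConst, volume_restrict_cube, funext (h a b), integral_const_mul,
    integral_det_mul_det _ (fun (i : Fin n) (y : ℝ) => y ^ (i : ℕ))
    (fun (j : Fin n) (y : ℝ) => jacobiWeight a b y * (1 - y) ^ (Fin.rev j : ℕ))
    fun i j => (moment_jacobiWeight ha hb i (Fin.rev j)).1]
  simp only [(moment_jacobiWeight ha hb _ _).2]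
  have hmat : (Matrix.of fun i j : Fin n => Gamma (a + 1 + (i : ℕ)) *
      Gamma (b + 1 + (Fin.rev j : ℕ)) / Gamma (a + b + 2 + (i : ℕ) + (Fin.rev j : ℕ))).det =
      (∏ i : Fin n, Gamma (a + 1 + (i : ℕ))) * ((∏ j : Fin n, Gamma (b + 1 + (Fin.rev j : ℕ))) *
      (Matrix.of fun i j : Fin n =>
        (Gamma (a + b + 2 + (i : ℕ) + (Fin.rev j : ℕ)))⁻¹).det) := by
    rw [← Matrix.det_mul_row, ← Matrix.det_mul_column]
    congr 1
    ext i j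
    simp only [Matrix.of_apply]
    ring
  have hrev : ∏ j : Fin n, Gamma (b + 1 + (Fin.rev j : ℕ)) =
      ∏ j : Fin n, Gamma (b + 1 + (j : ℕ)) :=
    Equiv.prod_comp (Fin.revPerm (n := n)) fun j : Fin n => Gamma (b + 1 + (j : ℕ))
  have hgam : ∏ i : Fin n, (Gamma (a + b + 2 + (i : ℕ) + (n - 1 : ℕ)))⁻¹ =
      ∏ i : Fin n, (Gamma (a + b + 1 + n + (i : ℕ)))⁻¹ := by
    refine Finset.prod_congr rfl fun i _ => ?_
    have : 1 ≤ n := by have := i.isLt; omega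
    rw [Nat.cast_sub this]
    push_cast
    ring_nf
  rw [hmat, det_inv_Gamma n (by linarith), hrev, hgam, Finset.prod_range
    (fun j : ℕ => Gamma (a + 1 + j) * Gamma (b + 1 + j) / Gamma (a + b + 1 + n + j))]
  simp only [div_eq_mul_inv, Finset.prod_mul_distrib]
  ring

theorem jueConst_pos (n : ℕ) {a b : ℝ} (ha : -1 < a) (hb : -1 < b) : 0 < jueConst n a b := by
  obtain ⟨κ, hκ, h⟩ := exists_jueConst_eq n
  refine lt_of_le_of_ne ?_ ?_
  · exact setIntegral_nonneg (MeasurableSet.univ_pi fun _ => measurableSet_Icc)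
      fun x hx => jueWeight_nonneg n a b hx
  · rw [h a b ha hb]
    refine (mul_ne_zero hκ (Finset.prod_ne_zero_iff.2 fun j hj => ?_)).symm
    have hj' : (j : ℝ) + 1 ≤ n := by exact_mod_cast Finset.mem_range.1 hj
    have hj0 : (0 : ℝ) ≤ j := Nat.cast_nonneg j
    have h1 := Gamma_pos_of_pos (show 0 < a + 1 + j by linarith)
    have h2 := Gamma_pos_of_pos (show 0 < b + 1 + j by linarith)
    have h3 := Gamma_pos_of_pos (show 0 < a + b + 1 + n + j by linarith)
    positivity

/-! ### The gap probability as the hard edge is approached -/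

theorem jueProb_eq (n : ℕ) {α β t : ℝ} (hα : -1 < α) (hβ : -1 < β) (ht : 0 ≤ t) :
    jueProb t α β n =
      (∫ x in Set.univ.pi fun _ : Fin n => Icc t 1, jueWeight n α β x) / jueConst n α β := by
  have hsub : (Set.univ.pi fun _ : Fin n => Icc t 1) ⊆
      Set.univ.pi fun _ : Fin n => Icc (0 : ℝ) 1 :=
    Set.pi_mono fun _ _ => Icc_subset_Icc_left ht
  have hm : MeasurableSet (Set.univ.pi fun _ : Fin n => Icc t 1) :=
    MeasurableSet.univ_pi fun _ => measurableSet_Icc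
  have hint := ((integrableOn_jueWeight n hα hβ).mono_set hsub).const_mul (1 / jueConst n α β)
  rw [jueProb, measureReal_def, jueLaw, withDensity_apply _ hm, Measure.restrict_restrict hm,
    Set.inter_eq_left.2 hsub, ← ofReal_integral_eq_lintegral_ofReal hint,
    ENNReal.toReal_ofReal, integral_const_mul]
  · ring
  · exact setIntegral_nonneg hm fun x hx =>
      mul_nonneg (one_div_nonneg.2 (jueConst_pos n hα hβ).le) (jueWeight_nonneg n α β (hsub hx))
  · refine (ae_restrict_iff' hm).2 (Eventually.of_forall fun x hx => ?_)
    exact mul_nonneg (one_div_nonneg.2 (jueConst_pos n hα hβ).le)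
      (jueWeight_nonneg n α β (hsub hx))

/-- The reflection `x ↦ 1 - x` exchanges the two endpoints. -/
theorem setIntegral_jueWeight_reflect (n : ℕ) (b t : ℝ) :
    ∫ x in Set.univ.pi fun _ : Fin n => Icc t 1, jueWeight n 0 b x =
      ∫ y in Set.univ.pi fun _ : Fin n => Icc 0 (1 - t), jueWeight n b 0 y := by
  rw [← integral_indicator (MeasurableSet.univ_pi fun _ => measurableSet_Icc),
    ← integral_indicator (MeasurableSet.univ_pi fun _ => measurableSet_Icc),
    ← integral_sub_left_eq_self _ volume (1 : Fin n → ℝ)]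
  congr 1
  ext y
  have hiff : (1 - y ∈ Set.univ.pi fun _ : Fin n => Icc t 1) ↔
      y ∈ Set.univ.pi fun _ : Fin n => Icc 0 (1 - t) := by
    simp only [Set.mem_univ_pi, mem_Icc, Pi.sub_apply, Pi.one_apply]
    refine forall_congr' fun i => ⟨fun h => ⟨?_, ?_⟩, fun h => ⟨?_, ?_⟩⟩ <;> linarith [h.1, h.2]
  have hw : jueWeight n 0 b (1 - y) = jueWeight n b 0 y := by
    simp only [jueWeight, jacobiWeight, Pi.sub_apply, Pi.one_apply, rpow_zero, one_mul, mul_one,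
      sub_sub_cancel]
    congr 1
    exact Finset.prod_congr rfl fun i _ => Finset.prod_congr rfl fun j _ => by ring
  by_cases hy : y ∈ Set.univ.pi fun _ : Fin n => Icc 0 (1 - t)
  · rw [indicator_of_mem (hiff.2 hy), indicator_of_mem hy, hw]
  · rw [indicator_of_notMem (fun h => hy (hiff.1 h)), indicator_of_notMem hy]

theorem prod_Ioi_sq (n : ℕ) (s : ℝ) :
    ∏ i : Fin n, ∏ _j ∈ Finset.Ioi i, s ^ 2 = s ^ (n * (n - 1)) := by
  simp only [Finset.prod_const, Fin.card_Ioi, Finset.prod_pow_eq_pow_sum, ← pow_mul]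
  congr 1
  rw [← Finset.mul_sum, Fin.sum_univ_eq_sum_range (fun i => n - 1 - i),
    Finset.sum_range_reflect (fun i => i) n, mul_comm, Finset.sum_range_id_mul_two]

theorem setIntegral_jueWeight_smul (n : ℕ) (b : ℝ) {s : ℝ} (hs : 0 < s) :
    ∫ y in Set.univ.pi fun _ : Fin n => Icc 0 s, jueWeight n b 0 y =
      s ^ ((n : ℝ) * (n + b)) *
        ∫ y in Set.univ.pi fun _ : Fin n => Icc (0 : ℝ) 1, jueWeight n b 0 y := by
  have h := Measure.integral_comp_smul (volume : Measure (Fin n → ℝ))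
    ((Set.univ.pi fun _ : Fin n => Icc 0 s).indicator (jueWeight n b 0)) s
  have hfun : (fun y : Fin n → ℝ =>
      (Set.univ.pi fun _ : Fin n => Icc 0 s).indicator (jueWeight n b 0) (s • y)) =
      fun y => (s ^ (n * (n - 1)) * (s ^ b) ^ n) *
        (Set.univ.pi fun _ : Fin n => Icc (0 : ℝ) 1).indicator (jueWeight n b 0) y := by
    ext y
    have hiff : (s • y ∈ Set.univ.pi fun _ : Fin n => Icc 0 s) ↔
        y ∈ Set.univ.pi fun _ : Fin n => Icc (0 : ℝ) 1 := by
      simp only [Set.mem_univ_pi, mem_Icc, Pi.smul_apply, smul_eq_mul]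
      refine forall_congr' fun i => and_congr ?_ ?_
      · exact mul_nonneg_iff_of_pos_left hs
      · exact mul_le_iff_le_one_right hs
    by_cases hy : y ∈ Set.univ.pi fun _ : Fin n => Icc (0 : ℝ) 1
    · rw [indicator_of_mem (hiff.2 hy), indicator_of_mem hy]
      simp only [jueWeight, jacobiWeight, Pi.smul_apply, smul_eq_mul, rpow_zero, mul_one,
        ← mul_sub, mul_pow, Finset.prod_mul_distrib, prod_Ioi_sq]
      rw [Finset.prod_congr rfl fun k _ => mul_rpow hs.le (hy k (mem_univ k)).1,
        Finset.prod_mul_distrib]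
      simp only [Finset.prod_const, Finset.card_univ, Fintype.card_fin]
      ring
    · rw [indicator_of_notMem (fun h => hy (hiff.1 h)), indicator_of_notMem hy, mul_zero]
  rw [hfun, integral_const_mul, integral_indicator (MeasurableSet.univ_pi fun _ => measurableSet_Icc),
    integral_indicator (MeasurableSet.univ_pi fun _ => measurableSet_Icc),
    Module.finrank_fin_fun, abs_of_pos (by positivity), smul_eq_mul] at h
  have hexp : s ^ ((n : ℝ) * (n + b)) = s ^ n * (s ^ (n * (n - 1)) * (s ^ b) ^ n) := by
    rw [← rpow_natCast (s ^ b), ← rpow_mul hs.le, ← rpow_natCast, ← rpow_natCast, ← rpow_add hs,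
      ← rpow_add hs]
    congr 1
    rcases n with _ | n
    · simp
    · push_cast [Nat.add_sub_cancel]
      ring
  rw [hexp, mul_assoc, h, ← mul_assoc, mul_inv_cancel₀ (by positivity), one_mul]

/-- Without the factor `x ^ α`, the mass of `[t, 1] ^ n` is computed by homogeneity. -/
theorem setIntegral_jueWeight_zero_left (n : ℕ) (b : ℝ) {t : ℝ} (ht : t < 1) :
    ∫ x in Set.univ.pi fun _ : Fin n => Icc t 1, jueWeight n 0 b x =
      (1 - t) ^ ((n : ℝ) * (n + b)) * jueConst n 0 b := by
  rw [setIntegral_jueWeight_reflect, setIntegral_jueWeight_smul n b (sub_pos.2 ht), jueConst,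
    setIntegral_jueWeight_reflect n b 0, sub_zero]

theorem jueWeight_eq_prod_mul (n : ℕ) (a b : ℝ) (x : Fin n → ℝ) :
    jueWeight n a b x = (∏ k, x k ^ a) * jueWeight n 0 b x := by
  simp only [jueWeight, jacobiWeight, rpow_zero, one_mul, Finset.prod_mul_distrib]
  ring

/-- On `[t, 1] ^ n` the factor `∏ x_k ^ α` lies between `exp (∓ n |α| |log t|)`. -/
theorem prod_rpow_bounds (n : ℕ) (a : ℝ) {t : ℝ} (ht : 0 < t) {x : Fin n → ℝ}
    (hx : x ∈ Set.univ.pi fun _ : Fin n => Icc t 1) :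
    Real.exp (-(n * (|a| * |Real.log t|))) ≤ ∏ k, x k ^ a ∧
      ∏ k, x k ^ a ≤ Real.exp (n * (|a| * |Real.log t|)) := by
  have hprod : ∏ k, x k ^ a = Real.exp (∑ k, Real.log (x k) * a) := by
    rw [Real.exp_sum]
    exact Finset.prod_congr rfl fun k _ =>
      rpow_def_of_pos (ht.trans_le (hx k (mem_univ k)).1) a
  have hb : |∑ k, Real.log (x k) * a| ≤ n * (|a| * |Real.log t|) := by
    refine (Finset.abs_sum_le_sum_abs _ _).trans ?_
    refine (Finset.sum_le_card_nsmul _ _ (|a| * |Real.log t|) fun k _ => ?_).trans ?_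
    · have h := hx k (mem_univ k)
      have h0 := ht.trans_le h.1
      rw [abs_mul, mul_comm, abs_of_nonpos (log_nonpos h0.le h.2),
        abs_of_nonpos (log_nonpos ht.le (h.1.trans h.2))]
      have := log_le_log ht h.1
      gcongr
    · simp
  rw [hprod, Real.exp_le_exp, Real.exp_le_exp]
  exact abs_le.1 hb

theorem abs_log_jueProb_sub_le (n : ℕ) {α β t : ℝ} (hα : -1 < α) (hβ : -1 < β)
    (ht : t ∈ Ioo (0 : ℝ) 1) :
    0 < jueProb t α β n ∧
    |Real.log (jueProb t α β n) - n * (n + β) * Real.log (1 - t)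
      - Real.log (jueConst n 0 β / jueConst n α β)| ≤ n * (|α| * |Real.log t|) := by
  have hm : MeasurableSet (Set.univ.pi fun _ : Fin n => Icc t 1) :=
    MeasurableSet.univ_pi fun _ => measurableSet_Icc
  have hsub : (Set.univ.pi fun _ : Fin n => Icc t 1) ⊆
      Set.univ.pi fun _ : Fin n => Icc (0 : ℝ) 1 :=
    Set.pi_mono fun _ _ => Icc_subset_Icc_left ht.1.le
  have h1t : 0 < 1 - t := sub_pos.2 ht.2
  have hC := jueConst_pos n hα hβ
  have hC0 := jueConst_pos n (a := 0) (by norm_num) hβ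
  set M : ℝ := n * (|α| * |Real.log t|)
  have hI := (integrableOn_jueWeight n hα hβ).mono_set hsub
  have hI0 := (integrableOn_jueWeight n (a := 0) (by norm_num) hβ).mono_set hsub
  have hN0 := setIntegral_jueWeight_zero_left n β ht.2
  set N0 := ∫ x in Set.univ.pi fun _ : Fin n => Icc t 1, jueWeight n 0 β x
  set N := ∫ x in Set.univ.pi fun _ : Fin n => Icc t 1, jueWeight n α β x with hN
  have hN0pos : 0 < N0 := hN0 ▸ by positivity
  have hlow : Real.exp (-M) * N0 ≤ N := by
    rw [hN, ← integral_const_mul]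
    refine setIntegral_mono_on (hI0.const_mul _) hI hm fun x hx => ?_
    rw [jueWeight_eq_prod_mul n α β x]
    exact mul_le_mul_of_nonneg_right (prod_rpow_bounds n α ht.1 hx).1
      (jueWeight_nonneg n 0 β (hsub hx))
  have hupp : N ≤ Real.exp M * N0 := by
    rw [hN, ← integral_const_mul]
    refine setIntegral_mono_on hI (hI0.const_mul _) hm fun x hx => ?_
    rw [jueWeight_eq_prod_mul n α β x]
    exact mul_le_mul_of_nonneg_right (prod_rpow_bounds n α ht.1 hx).2
      (jueWeight_nonneg n 0 β (hsub hx))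
  have hNpos : 0 < N := lt_of_lt_of_le (by positivity) hlow
  rw [jueProb_eq n hα hβ ht.1.le]
  refine ⟨div_pos hNpos hC, ?_⟩
  have hlogN0 : Real.log N0 = n * (n + β) * Real.log (1 - t) + Real.log (jueConst n 0 β) := by
    rw [hN0, log_mul (by positivity) hC0.ne', log_rpow h1t]
  have h1 := log_le_log (by positivity) hlow
  have h2 := log_le_log hNpos hupp
  rw [log_mul (by positivity) hN0pos.ne', Real.log_exp] at h1 h2
  rw [log_div hNpos.ne' hC.ne', log_div hC0.ne' hC.ne', abs_le]
  constructor <;> linarith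

theorem log_isBigO_one_sub : Real.log =O[𝓝[<] (1 : ℝ)] fun t : ℝ => 1 - t := by
  refine IsBigO.of_bound 2 ?_
  filter_upwards [Ioo_mem_nhdsLT (show (1 / 2 : ℝ) < 1 by norm_num)] with t ht
  have h0 : 0 < t := by linarith [ht.1]
  rw [norm_eq_abs, norm_eq_abs, abs_of_nonpos (log_nonpos h0.le ht.2.le),
    abs_of_pos (by linarith [ht.2])]
  have h1 := one_sub_inv_le_log_of_pos h0
  have h2 : t⁻¹ - 1 ≤ 2 * (1 - t) := by
    have : t⁻¹ - 1 = t⁻¹ * (1 - t) := by field_simp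
    rw [this]
    refine mul_le_mul_of_nonneg_right ?_ (by linarith [ht.2])
    rw [inv_le_comm₀ h0 (by norm_num)]
    linarith [ht.1]
  linarith

/-! ### Sequences tending to zero with small increments -/

theorem abs_le_of_tendsto_zero_of_abs_sub_le {u v : ℕ → ℝ} {N : ℕ}
    (hu : Tendsto u atTop (𝓝 0)) (hv : Tendsto v atTop (𝓝 0))
    (h : ∀ n ≥ N, |u (n + 1) - u n| ≤ v n - v (n + 1)) : ∀ n ≥ N, |u n| ≤ v n := by
  intro n hn
  have key : ∀ m, |u (n + m) - u n| ≤ v n - v (n + m) := by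
    intro m
    induction m with
    | zero => simp
    | succ m ih =>
      have h1 := h (n + m) (by omega)
      have h2 := abs_add_le (u (n + m + 1) - u (n + m)) (u (n + m) - u n)
      rw [sub_add_sub_cancel] at h2
      rw [← add_assoc]
      linarith
  have hshift : Tendsto (fun m => n + m) atTop atTop :=
    tendsto_atTop_mono (fun m => Nat.le_add_left m n) tendsto_id
  have h1 := ((hu.comp hshift).sub_const (u n)).abs
  have h2 := (hv.comp hshift).const_sub (v n)
  simpa using le_of_tendsto_of_tendsto' h1 h2 key

/-- A null sequence whose increments are `O(1 / n ^ (p + 1))` is `O(1 / n ^ p)`. -/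
theorem isBigO_of_tendsto_zero_of_sub_isBigO {u : ℕ → ℝ} {p : ℕ} (hp : 1 ≤ p)
    (hu : Tendsto u atTop (𝓝 0))
    (h : (fun n => u (n + 1) - u n) =O[atTop] fun n : ℕ => ((n : ℝ) ^ (p + 1))⁻¹) :
    u =O[atTop] fun n : ℕ => ((n : ℝ) ^ p)⁻¹ := by
  obtain ⟨C, hC, hb⟩ := h.exists_pos
  obtain ⟨N, hN⟩ := eventually_atTop.1 hb.bound
  have hv : Tendsto (fun n : ℕ => 2 * C * ((n : ℝ) ^ p)⁻¹) atTop (𝓝 0) := by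
    have := (tendsto_inv_atTop_zero.comp ((tendsto_pow_atTop (α := ℝ) (n := p) (by omega)).comp
      tendsto_natCast_atTop_atTop)).const_mul (2 * C)
    simpa using this
  have key := abs_le_of_tendsto_zero_of_abs_sub_le (N := max N 1) hu hv fun n hn => by
    have h1 := hN n (le_of_max_le_left hn)
    have hn1 : (1 : ℝ) ≤ n := by exact_mod_cast le_of_max_le_right hn
    have hn0 : (0 : ℝ) < n := by linarith
    rw [norm_eq_abs, norm_of_nonneg (show (0 : ℝ) ≤ ((n : ℝ) ^ (p + 1))⁻¹ by positivity)] at h1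
    refine h1.trans ?_
    -- `n ^ p / (n + 1) ^ p ≤ n / (n + 1)`, and `1 - n / (n + 1) = 1 / (n + 1) ≥ 1 / (2 n)`
    have h2 : ((((n + 1 : ℕ) : ℝ)) ^ p)⁻¹ ≤ ((n : ℝ) ^ p)⁻¹ * (n / (n + 1)) := by
      have : ((n : ℝ) / (n + 1)) ^ p ≤ n / (n + 1) :=
        pow_le_of_le_one (by positivity) ((div_le_one (by positivity)).2 (by linarith))
          (by omega)
      calc ((((n + 1 : ℕ) : ℝ)) ^ p)⁻¹ = ((n : ℝ) ^ p)⁻¹ * ((n : ℝ) / (n + 1)) ^ p := by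
            push_cast; rw [div_pow]; field_simp
        _ ≤ _ := mul_le_mul_of_nonneg_left this (by positivity)
    have h3 : ((n : ℝ) ^ (p + 1))⁻¹ ≤ 2 * (((n : ℝ) ^ p)⁻¹ * (1 - n / (n + 1))) := by
      have : (1 : ℝ) - n / (n + 1) = (n + 1 : ℝ)⁻¹ := by field_simp; ring
      rw [this, pow_succ, mul_inv, mul_left_comm]
      refine mul_le_mul_of_nonneg_left ?_ (by positivity)
      rw [← div_eq_mul_inv, inv_eq_one_div, div_le_div_iff₀ hn0 (by positivity)]
      linarith
    calc C * ((n : ℝ) ^ (p + 1))⁻¹ ≤ C * (2 * (((n : ℝ) ^ p)⁻¹ * (1 - n / (n + 1)))) := by gcongr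
      _ = 2 * C * (((n : ℝ) ^ p)⁻¹ - ((n : ℝ) ^ p)⁻¹ * (n / (n + 1))) := by ring
      _ ≤ 2 * C * (((n : ℝ) ^ p)⁻¹ - ((((n + 1 : ℕ) : ℝ)) ^ p)⁻¹) := by gcongr
      _ = _ := by ring
  refine IsBigO.of_bound (2 * C) ?_
  filter_upwards [eventually_ge_atTop (max N 1)] with n hn
  rw [norm_eq_abs, norm_eq_abs, abs_of_nonneg (show (0 : ℝ) ≤ ((n : ℝ) ^ p)⁻¹ by positivity)]
  exact key n hn

/-! ### Expansions of logarithms -/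

theorem log_one_add_sub_isBigO :
    (fun x : ℝ => Real.log (1 + x) - (x - x ^ 2 / 2)) =O[𝓝 0] fun x => x ^ 3 := by
  refine IsBigO.of_bound 2 ?_
  filter_upwards [Metric.ball_mem_nhds (0 : ℝ) (show (0 : ℝ) < 1 / 2 by norm_num)] with x hx
  rw [Metric.mem_ball, dist_zero_right, norm_eq_abs] at hx
  have h := abs_log_sub_add_sum_range_le (x := -x) (by rw [abs_neg]; linarith) 2
  simp only [Finset.sum_range_succ, Finset.range_zero, Finset.sum_empty, abs_neg] at h
  rw [norm_eq_abs, norm_eq_abs, abs_pow]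
  have h2 : |x| ^ 3 / (1 - |x|) ≤ 2 * |x| ^ 3 := by
    rw [div_le_iff₀ (by linarith)]
    nlinarith [pow_nonneg (abs_nonneg x) 3]
  refine le_trans (le_of_eq_of_le ?_ h) h2
  congr 1
  norm_num
  ring

theorem tendsto_const_div_natCast (w : ℝ) :
    Tendsto (fun n : ℕ => w / (n : ℝ)) atTop (𝓝 0) :=
  tendsto_const_nhds.div_atTop tendsto_natCast_atTop_atTop

theorem log_one_add_div_isBigO (w : ℝ) :
    (fun n : ℕ => Real.log (1 + w / n) - (w / n - (w / n) ^ 2 / 2)) =O[atTop]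
      fun n : ℕ => ((n : ℝ) ^ 3)⁻¹ := by
  refine (log_one_add_sub_isBigO.comp_tendsto (tendsto_const_div_natCast w)).trans ?_
  refine IsBigO.of_bound |w ^ 3| (Eventually.of_forall fun n => ?_)
  simp [div_eq_mul_inv, mul_pow]

theorem isBigO_natCast_pow_inv {p q : ℕ} (h : p ≤ q) :
    (fun n : ℕ => ((n : ℝ) ^ q)⁻¹) =O[atTop] fun n : ℕ => ((n : ℝ) ^ p)⁻¹ := by
  refine IsBigO.of_bound 1 ?_
  filter_upwards [eventually_ge_atTop 1] with n hn
  have hn1 : (1 : ℝ) ≤ n := by exact_mod_cast hn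
  rw [norm_eq_abs, norm_eq_abs, abs_of_nonneg (by positivity), abs_of_nonneg (by positivity),
    one_mul]
  gcongr

theorem isBigO_natCast_succ_pow_inv (p : ℕ) :
    (fun n : ℕ => (((n + 1 : ℕ) : ℝ) ^ p)⁻¹) =O[atTop] fun n : ℕ => ((n : ℝ) ^ p)⁻¹ := by
  refine IsBigO.of_bound 1 ?_
  filter_upwards [eventually_ge_atTop 1] with n hn
  have hn1 : (1 : ℝ) ≤ n := by exact_mod_cast hn
  rw [norm_eq_abs, norm_eq_abs, abs_of_nonneg (by positivity), abs_of_nonneg (by positivity),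
    one_mul]
  gcongr
  linarith

theorem isBigO_inv_mul_succ_inv (p : ℕ) :
    (fun n : ℕ => ((n : ℝ) ^ p * (n + 1))⁻¹) =O[atTop] fun n : ℕ => ((n : ℝ) ^ (p + 1))⁻¹ := by
  refine IsBigO.of_bound 1 ?_
  filter_upwards [eventually_ge_atTop 1] with n hn
  have hn1 : (1 : ℝ) ≤ n := by exact_mod_cast hn
  rw [norm_eq_abs, norm_eq_abs, abs_of_nonneg (by positivity), abs_of_nonneg (by positivity),
    one_mul, pow_succ]
  gcongr
  linarith

theorem harmonic_sub_isBigO :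
    (fun n : ℕ => (harmonic n : ℝ) - Real.log n - eulerMascheroniConstant) =O[atTop]
      fun n : ℕ => (n : ℝ)⁻¹ := by
  have h0 : Tendsto (fun n : ℕ => (harmonic n : ℝ) - Real.log n - eulerMascheroniConstant)
      atTop (𝓝 0) := by
    simpa using tendsto_harmonic_sub_log.sub_const eulerMascheroniConstant
  have h := isBigO_of_tendsto_zero_of_sub_isBigO (p := 1) le_rfl h0 ?_
  · simpa using h
  have h1 := (log_one_add_div_isBigO 1).trans (isBigO_natCast_pow_inv (show 2 ≤ 3 by norm_num))
  have h2 := (isBigO_refl (fun n : ℕ => ((n : ℝ) ^ 2)⁻¹) atTop).const_mul_left (1 / 2)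
  have h3 : (fun n : ℕ => ((n : ℝ) ^ 1 * (n + 1))⁻¹) =O[atTop] fun n : ℕ => ((n : ℝ) ^ 2)⁻¹ :=
    isBigO_inv_mul_succ_inv 1
  refine ((h2.sub h1).sub h3).congr' ?_ (EventuallyEq.refl _ _)
  filter_upwards [eventually_ge_atTop 1] with n hn
  have hn0 : (0 : ℝ) < n := by exact_mod_cast hn
  have hlog : Real.log (1 + 1 / n) = Real.log ((n + 1 : ℕ) : ℝ) - Real.log n := by
    rw [← log_div (by positivity) hn0.ne']
    congr 1
    push_cast
    field_simp
  rw [hlog, harmonic_succ]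
  push_cast
  field_simp
  ring

/-! ### Ratios of Gamma functions with three terms of Stirling's expansion -/

theorem log_Gamma_add_one {x : ℝ} (hx : 0 < x) :
    Real.log (Gamma (x + 1)) = Real.log (Gamma x) + Real.log x := by
  rw [Gamma_add_one hx.ne', log_mul hx.ne' (Gamma_pos_of_pos hx).ne', add_comm]

theorem log_Gamma_add_natCast {x : ℝ} (hx : 0 < x) (n : ℕ) :
    Real.log (Gamma (x + n)) = Real.log (Gamma x) + ∑ m ∈ Finset.range n, Real.log (x + m) := by
  induction n with
  | zero => simp
  | succ n ih =>
    rw [Finset.sum_range_succ, ← add_assoc, ← ih, Nat.cast_succ, ← add_assoc,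
      log_Gamma_add_one (by positivity)]

theorem tendsto_log_Gamma_sub {w : ℝ} (hw : -1 < w) :
    Tendsto (fun n : ℕ => Real.log (Gamma (w + n + 1)) - Real.log (Gamma (n + 1)) -
      w * Real.log n) atTop (𝓝 0) := by
  have hx : 0 < w + 1 := by linarith
  have h1 := (BohrMollerup.tendsto_log_gamma hx).const_sub (Real.log (Gamma (w + 1)))
  rw [sub_self] at h1
  -- `log n - log (w + n + 1) → 0` accounts for the last factor of the Euler product
  have h2 : Tendsto (fun n : ℕ => Real.log (1 + (w + 1) / n)) atTop (𝓝 0) := by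
    have := ((tendsto_const_div_natCast (w + 1)).const_add 1).log (by norm_num)
    simpa using this
  have h3 := h1.sub h2
  rw [sub_zero] at h3
  refine h3.congr' ?_
  filter_upwards [eventually_ge_atTop 1] with n hn
  have hn0 : (0 : ℝ) < n := by exact_mod_cast hn
  have e1 := log_Gamma_add_natCast hx n
  have e2 : Real.log (1 + (w + 1) / n) = Real.log (w + 1 + n) - Real.log n := by
    rw [← log_div (by positivity) hn0.ne']
    congr 1
    field_simp
    ring
  rw [e2, BohrMollerup.logGammaSeq, Gamma_nat_eq_factorial, Finset.sum_range_succ,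
    show w + n + 1 = w + 1 + n by ring, e1]
  ring

theorem log_Gamma_sub_isBigO {w : ℝ} (hw : -1 < w) :
    (fun n : ℕ => Real.log (Gamma (w + n + 1)) - Real.log (Gamma (n + 1)) -
      w * Real.log n - w * (w + 1) / 2 * (n : ℝ)⁻¹) =O[atTop] fun n : ℕ => ((n : ℝ) ^ 2)⁻¹ := by
  refine isBigO_of_tendsto_zero_of_sub_isBigO (p := 2) (by norm_num) ?_ ?_
  · have := (tendsto_log_Gamma_sub hw).sub (tendsto_const_div_natCast (w * (w + 1) / 2))
    simpa [div_eq_mul_inv] using this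
  have h1 := log_one_add_div_isBigO (w + 1)
  have h2 := (log_one_add_div_isBigO 1).const_mul_left (w + 1)
  have h3 : (fun n : ℕ => w * (w + 1) / 2 * ((n : ℝ) ^ 2 * (n + 1))⁻¹) =O[atTop]
      fun n : ℕ => ((n : ℝ) ^ 3)⁻¹ := (isBigO_inv_mul_succ_inv 2).const_mul_left _
  refine ((h1.sub h2).sub h3).congr' ?_ (EventuallyEq.refl _ _)
  filter_upwards [eventually_ge_atTop 1] with n hn
  have hn0 : (0 : ℝ) < n := by exact_mod_cast hn
  have hn1 : (1 : ℝ) ≤ n := by exact_mod_cast hn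
  have e1 : Real.log (1 + (w + 1) / n) = Real.log (w + n + 1) - Real.log n := by
    rw [← log_div (by linarith) hn0.ne']
    congr 1
    field_simp
    ring
  have e2 : Real.log (1 + 1 / n) = Real.log (n + 1) - Real.log n := by
    rw [← log_div (by positivity) hn0.ne']
    congr 1
    field_simp
  have e3 : Real.log (Gamma (w + (n + 1 : ℕ) + 1)) =
      Real.log (Gamma (w + n + 1)) + Real.log (w + n + 1) := by
    rw [← log_Gamma_add_one (by linarith)]
    push_cast
    ring_nf
  have e4 : Real.log (Gamma ((n + 1 : ℕ) + 1)) =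
      Real.log (Gamma (n + 1)) + Real.log (n + 1) := by
    rw [← log_Gamma_add_one (by positivity)]
    push_cast
    ring_nf
  rw [e1, e2, e3, e4]
  push_cast
  field_simp
  ring

/-! ### The logarithm of the Barnes G-function -/

/-- The logarithm of the `k`-th factor (counted from `0`) in the Weierstrass product of
`barnesG (w + 1)`. -/
noncomputable def logBarnesGFactor (w : ℝ) (k : ℕ) : ℝ :=
  (k + 1) * Real.log (1 + w / (k + 1)) + (w ^ 2 / (2 * (k + 1)) - w)

theorem one_add_div_succ_pos {w : ℝ} (hw : -1 < w) (k : ℕ) : 0 < 1 + w / ((k : ℝ) + 1) := by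
  have hk : (0 : ℝ) ≤ k := Nat.cast_nonneg k
  have : 1 + w / ((k : ℝ) + 1) = (k + 1 + w) / (k + 1) := by field_simp
  rw [this]
  exact div_pos (by linarith) (by positivity)

theorem logBarnesGFactor_isBigO (w : ℝ) :
    logBarnesGFactor w =O[atTop] fun n : ℕ => ((n : ℝ) ^ 2)⁻¹ := by
  have h1 := (log_one_add_div_isBigO w).comp_tendsto (tendsto_add_atTop_nat 1)
  have h2 := (isBigO_refl (fun n : ℕ => ((n + 1 : ℕ) : ℝ)) atTop).mul h1
  refine (h2.congr (fun n => ?_) fun n => ?_).trans (isBigO_natCast_succ_pow_inv 2)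
  · simp only [Function.comp_apply, logBarnesGFactor]
    push_cast
    field_simp
    ring
  · simp only [Function.comp_apply]
    field_simp

theorem summable_logBarnesGFactor (w : ℝ) : Summable (logBarnesGFactor w) := by
  refine summable_of_isBigO_nat (Real.summable_nat_pow_inv.2 (by norm_num : 1 < 2)) ?_
  exact logBarnesGFactor_isBigO w

theorem barnesG_add_one_div {w : ℝ} (hw : -1 < w) :
    barnesG (w + 1) / (2 * π) ^ (w / 2) =
      Real.exp (-(w + (1 + eulerMascheroniConstant) * w ^ 2) / 2 +
        ∑' k, logBarnesGFactor w k) := by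
  have hprod : ∏' k : ℕ, (1 + w / ((k : ℝ) + 1)) ^ (k + 1) *
      Real.exp (w ^ 2 / (2 * ((k : ℝ) + 1)) - w) = Real.exp (∑' k, logBarnesGFactor w k) := by
    rw [← (summable_logBarnesGFactor w).hasSum.rexp.tprod_eq]
    refine tprod_congr fun k => ?_
    simp only [Function.comp_apply, logBarnesGFactor]
    rw [Real.exp_add, ← Nat.cast_succ, ← Nat.succ_eq_add_one, Real.exp_nat_mul,
      Real.exp_log (by simpa using one_add_div_succ_pos hw k)]
  have h2 : (0 : ℝ) < (2 * π) ^ (w / 2) := by positivity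
  rw [barnesG, add_sub_cancel_right, hprod, mul_assoc, mul_div_cancel_left₀ _ h2.ne', Real.exp_add]

theorem sum_logBarnesGFactor_sub_isBigO (w : ℝ) :
    (fun n : ℕ => ∑ k ∈ Finset.range n, logBarnesGFactor w k - ∑' k, logBarnesGFactor w k)
      =O[atTop] fun n : ℕ => (n : ℝ)⁻¹ := by
  have h0 : Tendsto (fun n : ℕ => ∑ k ∈ Finset.range n, logBarnesGFactor w k -
      ∑' k, logBarnesGFactor w k) atTop (𝓝 0) := by
    simpa using (summable_logBarnesGFactor w).hasSum.tendsto_sum_nat.sub_const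
      (∑' k, logBarnesGFactor w k)
  have h := isBigO_of_tendsto_zero_of_sub_isBigO (p := 1) le_rfl h0 ?_
  · simpa using h
  · simpa [Finset.sum_range_succ] using logBarnesGFactor_isBigO w

/-! ### Asymptotics of products of Gamma functions -/

/-- The logarithm of `∏_{j < n} Γ(w + j + 1) / Γ(j + 1)`, that is, of
`G(n + w + 1) / (G(w + 1) G(n + 1))`. -/
noncomputable def logGammaRatioSum (w : ℝ) (n : ℕ) : ℝ :=
  ∑ j ∈ Finset.range n, (Real.log (Gamma (w + j + 1)) - Real.log (Gamma (j + 1)))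

/-- Summation by parts. -/
theorem logGammaRatioSum_eq {w : ℝ} (hw : -1 < w) (n : ℕ) :
    logGammaRatioSum w n =
      n * (Real.log (Gamma (w + n + 1)) - Real.log (Gamma (n + 1))) -
        ∑ k ∈ Finset.range n, ((k : ℝ) + 1) * Real.log (1 + w / (k + 1)) := by
  rw [logGammaRatioSum]
  induction n with
  | zero => simp
  | succ n ih =>
    have hn : (0 : ℝ) ≤ n := Nat.cast_nonneg n
    have e1 : Real.log (1 + w / (n + 1)) = Real.log (w + n + 1) - Real.log (n + 1) := by
      rw [← log_div (by linarith) (by positivity)]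
      congr 1
      field_simp
      ring
    have e2 := log_Gamma_add_one (show 0 < w + n + 1 by linarith)
    have e3 := log_Gamma_add_one (show (0 : ℝ) < n + 1 by positivity)
    rw [Finset.sum_range_succ, Finset.sum_range_succ, ih, e1]
    push_cast
    rw [show w + ((n : ℝ) + 1) + 1 = w + n + 1 + 1 by ring, e2, e3]
    ring

theorem sum_mul_log_one_add_div (w : ℝ) (n : ℕ) :
    ∑ k ∈ Finset.range n, ((k : ℝ) + 1) * Real.log (1 + w / (k + 1)) =
      ∑ k ∈ Finset.range n, logBarnesGFactor w k - w ^ 2 / 2 * harmonic n + n * w := by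
  induction n with
  | zero => simp
  | succ n ih =>
    rw [Finset.sum_range_succ, Finset.sum_range_succ, ih, harmonic_succ, logBarnesGFactor]
    push_cast
    field_simp
    ring

theorem logGammaRatioSum_sub_isBigO {w : ℝ} (hw : -1 < w) :
    (fun n : ℕ => logGammaRatioSum w n - (n * w * Real.log n + w ^ 2 / 2 * Real.log n - n * w
      - Real.log (barnesG (w + 1) / (2 * π) ^ (w / 2)))) =O[atTop] fun n : ℕ => (n : ℝ)⁻¹ := by
  have h1 : (fun n : ℕ => (n : ℝ) * (Real.log (Gamma (w + n + 1)) - Real.log (Gamma (n + 1)) -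
      w * Real.log n - w * (w + 1) / 2 * (n : ℝ)⁻¹)) =O[atTop] fun n : ℕ => (n : ℝ)⁻¹ := by
    refine ((isBigO_refl (fun n : ℕ => (n : ℝ)) atTop).mul (log_Gamma_sub_isBigO hw)).congr'
      (EventuallyEq.refl _ _) ?_
    filter_upwards [eventually_ge_atTop 1] with n hn
    have hn0 : (0 : ℝ) < n := by exact_mod_cast hn
    field_simp
  refine ((h1.sub (sum_logBarnesGFactor_sub_isBigO w)).add
    (harmonic_sub_isBigO.const_mul_left (w ^ 2 / 2))).congr' ?_ (EventuallyEq.refl _ _)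
  filter_upwards [eventually_ge_atTop 1] with n hn
  have hn0 : (0 : ℝ) < n := by exact_mod_cast hn
  rw [logGammaRatioSum_eq hw, sum_mul_log_one_add_div, barnesG_add_one_div hw, Real.log_exp]
  field_simp
  ring

/-- The non-polynomial part `(x ^ 2 / 2 - 1 / 12) log x` of the large-`x` expansion of
`log G(1 + x)`. -/
noncomputable def barnesMainTerm (x : ℝ) : ℝ := (x ^ 2 / 2 - 1 / 12) * Real.log x

theorem barnesMainTerm_sub_isBigO (w : ℝ) :
    (fun n : ℕ => barnesMainTerm (n + w) - barnesMainTerm n -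
      (n * w * Real.log n + w ^ 2 / 2 * Real.log n + n * w / 2 + 3 / 4 * w ^ 2))
      =O[atTop] fun n : ℕ => (n : ℝ)⁻¹ := by
  have hinv : (fun n : ℕ => ((n : ℝ) ^ 2)⁻¹) =O[atTop] fun n : ℕ => (n : ℝ)⁻¹ := by
    simpa using isBigO_natCast_pow_inv (show 1 ≤ 2 by norm_num)
  have hinv3 : (fun n : ℕ => ((n : ℝ) ^ 3)⁻¹) =O[atTop] fun n : ℕ => (n : ℝ)⁻¹ := by
    simpa using isBigO_natCast_pow_inv (show 1 ≤ 3 by norm_num)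
  set e : ℕ → ℝ := fun n => Real.log (1 + w / n) - (w / n - (w / n) ^ 2 / 2) with he
  have hL : e =O[atTop] fun n : ℕ => ((n : ℝ) ^ 3)⁻¹ := log_one_add_div_isBigO w
  have hcancel : ∀ p : ℕ, (fun n : ℕ => (n : ℝ) ^ p * ((n : ℝ) ^ (p + 1))⁻¹) =ᶠ[atTop]
      fun n : ℕ => (n : ℝ)⁻¹ := fun p => by
    filter_upwards [eventually_ge_atTop 1] with n hn
    have hn0 : (0 : ℝ) < n := by exact_mod_cast hn
    field_simp
    exact (pow_succ _ p).symm
  have h2 : (fun n : ℕ => (n : ℝ) ^ 2 * e n) =O[atTop] fun n : ℕ => (n : ℝ)⁻¹ :=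
    ((isBigO_refl (fun n : ℕ => (n : ℝ) ^ 2) atTop).mul hL).congr'
      (EventuallyEq.refl _ _) (hcancel 2)
  have h1 : (fun n : ℕ => (n : ℝ) ^ 1 * e n) =O[atTop] fun n : ℕ => (n : ℝ)⁻¹ :=
    ((isBigO_refl (fun n : ℕ => (n : ℝ) ^ 1) atTop).mul
      (hL.trans (isBigO_natCast_pow_inv (show 2 ≤ 3 by norm_num)))).congr'
      (EventuallyEq.refl _ _) (hcancel 1)
  have hsum := ((((h2.const_mul_left (1 / 2)).add (h1.const_mul_left w)).add
    ((hL.trans hinv3).const_mul_left (w ^ 2 / 2 - 1 / 12))).add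
    ((isBigO_refl (fun n : ℕ => (n : ℝ)⁻¹) atTop).const_mul_left (-w / 12))).add
    (hinv.const_mul_left (-(w ^ 2 / 2 - 1 / 12) * w ^ 2 / 2))
  refine hsum.congr' ?_ (EventuallyEq.refl _ _)
  filter_upwards [eventually_gt_atTop ⌈|w|⌉₊, eventually_ge_atTop 1] with n hnw hn
  have hn0 : (0 : ℝ) < n := by exact_mod_cast hn
  have hpos : 0 < n + w := by
    have h3 := Nat.lt_of_ceil_lt hnw
    linarith [neg_abs_le w]
  have hlog : Real.log (n + w) = Real.log n + (e n + (w / n - (w / n) ^ 2 / 2)) := by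
    rw [he, sub_add_cancel, ← log_mul hn0.ne']
    · congr 1
      field_simp
    · rw [show 1 + w / (n : ℝ) = (n + w) / n by field_simp]
      positivity
  rw [barnesMainTerm, barnesMainTerm, hlog]
  field_simp
  ring

/-- The error in `log (G(n + w + 1) / (G(w + 1) G(n + 1)))` when both `G(n + w + 1)` and `G(n + 1)`
are replaced by the expansion of `log G` at infinity; the constant `ζ'(-1)` of that expansion
cancels. -/
noncomputable def logGammaRatioSumError (w : ℝ) (n : ℕ) : ℝ :=
  logGammaRatioSum w n - (barnesMainTerm (n + w) - barnesMainTerm n) + 3 / 2 * n * w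
    + 3 / 4 * w ^ 2 + Real.log (barnesG (w + 1) / (2 * π) ^ (w / 2))

theorem logGammaRatioSumError_isBigO {w : ℝ} (hw : -1 < w) :
    logGammaRatioSumError w =O[atTop] fun n : ℕ => (n : ℝ)⁻¹ := by
  refine ((logGammaRatioSum_sub_isBigO hw).sub (barnesMainTerm_sub_isBigO w)).congr_left
    fun n => ?_
  rw [logGammaRatioSumError]
  ring

theorem logGammaRatioSumError_add_self_isBigO {w : ℝ} (hw : -1 < w) :
    (fun n => logGammaRatioSumError w (n + n)) =O[atTop] fun n : ℕ => (n : ℝ)⁻¹ := by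
  have hshift : Tendsto (fun n : ℕ => n + n) atTop atTop :=
    tendsto_atTop_mono (fun n => Nat.le_add_left n n) tendsto_id
  refine ((logGammaRatioSumError_isBigO hw).comp_tendsto hshift).trans ?_
  refine IsBigO.of_bound 1 (Eventually.of_forall fun n => ?_)
  simp only [Function.comp_apply, Nat.cast_add, norm_inv, one_mul]
  rcases Nat.eq_zero_or_pos n with rfl | hn
  · simp
  have hn0 : (0 : ℝ) < n := by exact_mod_cast hn
  rw [norm_of_nonneg (by positivity), norm_of_nonneg (by positivity)]
  gcongr
  linarith

/-! ### The ratio of normalisation constants -/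

theorem log_jueConst_div {α β : ℝ} (hα : -1 < α) (hβ : 0 < β) (n : ℕ) :
    Real.log (jueConst n 0 β / jueConst n α β) =
      -logGammaRatioSum α n + (logGammaRatioSum (α + β) (n + n) - logGammaRatioSum (α + β) n)
        - (logGammaRatioSum β (n + n) - logGammaRatioSum β n) := by
  obtain ⟨κ, hκ, h⟩ := exists_jueConst_eq n
  rw [h 0 β (by norm_num) (by linarith), h α β hα (by linarith), mul_div_mul_left _ _ hκ,
    ← Finset.prod_div_distrib]
  have hterm : ∀ j : ℕ, 0 < Gamma (0 + 1 + j) ∧ 0 < Gamma (β + 1 + j) ∧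
      0 < Gamma (0 + β + 1 + n + j) ∧ 0 < Gamma (α + 1 + j) ∧ 0 < Gamma (α + β + 1 + n + j) := by
    intro j
    have hj : (0 : ℝ) ≤ j := Nat.cast_nonneg j
    have hn : (0 : ℝ) ≤ n := Nat.cast_nonneg n
    refine ⟨?_, ?_, ?_, ?_, ?_⟩ <;> exact Gamma_pos_of_pos (by linarith)
  rw [log_prod fun j _ => ?_]
  · simp only [logGammaRatioSum, Finset.sum_range_add, add_sub_cancel_left]
    rw [← Finset.sum_neg_distrib, ← Finset.sum_add_distrib, ← Finset.sum_sub_distrib]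
    refine Finset.sum_congr rfl fun j _ => ?_
    obtain ⟨h1, h2, h3, h4, h5⟩ := hterm j
    rw [log_div (by positivity) (by positivity), log_div (by positivity) h3.ne',
      log_div (by positivity) h5.ne', log_mul h1.ne' h2.ne', log_mul h4.ne' h2.ne']
    push_cast
    ring_nf
  · obtain ⟨h1, h2, h3, h4, h5⟩ := hterm j
    positivity

theorem mainTheorem5 (α β : ℝ) (hα : -1 < α) (hβ : 0 < β) :
    ∃ (E : ℕ → ℝ) (F : ℕ → ℝ → ℝ),
      (E =O[atTop] fun n : ℕ => (n : ℝ)⁻¹) ∧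
      (∀ n : ℕ, 1 ≤ n → (F n =O[𝓝[<] (1 : ℝ)] fun t : ℝ => 1 - t)) ∧
      ∀ n : ℕ, 1 ≤ n → ∀ t : ℝ, t ∈ Ioo (0 : ℝ) 1 →
        0 < jueProb t α β n ∧
        Real.log (jueProb t α β n) =
          (n : ℝ) * (n + β) * Real.log (1 - t) + n * α * Real.log t
          + Real.log (barnesG (α + 1) / (2 * π) ^ (α / 2)) + 3 / 4 * α ^ 2
          + ((n : ℝ) ^ 2 / 2 - 1 / 12) * Real.log n
          + (((n : ℝ) + β) ^ 2 / 2 - 1 / 12) * Real.log (n + β)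
          + ((2 * (n : ℝ) + α + β) ^ 2 / 2 - 1 / 12) * Real.log (2 * n + α + β)
          + (1 / 12 - ((n : ℝ) + α) ^ 2 / 2) * Real.log (n + α)
          + (1 / 12 - (2 * (n : ℝ) + β) ^ 2 / 2) * Real.log (2 * n + β)
          + (1 / 12 - ((n : ℝ) + α + β) ^ 2 / 2) * Real.log (n + α + β)
          + E n + F n t := by
  have hβ' : -1 < β := by linarith
  have hαβ : -1 < α + β := by linarith
  refine ⟨fun n => -logGammaRatioSumError α n +
      (logGammaRatioSumError (α + β) (n + n) - logGammaRatioSumError (α + β) n) -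
      (logGammaRatioSumError β (n + n) - logGammaRatioSumError β n),
    fun n t => Real.log (jueProb t α β n) - n * (n + β) * Real.log (1 - t)
      - Real.log (jueConst n 0 β / jueConst n α β) - n * α * Real.log t, ?_, fun n _ => ?_,
    fun n _ t ht => ⟨(abs_log_jueProb_sub_le n hα hβ' ht).1, ?_⟩⟩
  · exact ((logGammaRatioSumError_isBigO hα).neg_left.add
      ((logGammaRatioSumError_add_self_isBigO hαβ).sub (logGammaRatioSumError_isBigO hαβ))).sub
      ((logGammaRatioSumError_add_self_isBigO hβ').sub (logGammaRatioSumError_isBigO hβ'))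
  · have h1 : (fun t => Real.log (jueProb t α β n) - n * (n + β) * Real.log (1 - t)
        - Real.log (jueConst n 0 β / jueConst n α β)) =O[𝓝[<] (1 : ℝ)] Real.log := by
      refine IsBigO.of_bound (n * |α|) ?_
      filter_upwards [Ioo_mem_nhdsLT (show (0 : ℝ) < 1 by norm_num)] with t ht
      rw [norm_eq_abs, norm_eq_abs, mul_assoc (n : ℝ) |α|]
      exact (abs_log_jueProb_sub_le n hα hβ' ht).2
    exact (h1.sub ((isBigO_refl Real.log _).const_mul_left (n * α))).trans log_isBigO_one_sub
  · simp only [log_jueConst_div hα hβ, logGammaRatioSumError, barnesMainTerm]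
    push_cast
    ring_nf
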